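/- For integers $1\le k\le n$ let $B_{n,k}=\frac{k}{n}\binom{2n}{n-k}$ denote the entries of Shapiro's Catalan triangle (these are integers). Let $n=2^a$ with $a\ge 0$ an integer, and let $r\ge 0$ and $s,t\ge 1$ be integers such that $r+s+t$ is odd. Then $$\sum_{k=1}^{n}k^{r}\,B_{2n,k}^{\,s}\,B_{n,k}^{\,t}$$ is divisible by $\binom{4n-1}{n-1}$. -/

import Mathlib

/-- The entry `B_{n,k} = (k / n) * C(2n, n - k)` of Shapiro's Catalan triangle, as a rational
number. It is meant for `1 ≤ k ≤ n`, where `n ≠ 0` and the subtraction does not truncate. -/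
def catalanTriangle (n k : ℕ) : ℚ :=
  (k : ℚ) / (n : ℚ) * (Nat.choose (2 * n) (n - k) : ℚ)

/-! Since `k * choose (2N) (N-k) = N * B_{N,k}`, a power of 2 (as `n` is one) times the sum is an
odd moment of products of central-type binomials. Twice that moment is divisible by `choose (4n) n =
4 * choose (4n-1) (n-1)` for every `n` (`two_mul_sum_odd_pow_choose`), and `choose (4n-1) (n-1)` is
odd because `4n` is a power of 2, so the power of 2 cancels. The moment bound is an induction on the
number of factors (`two_mul_sum_odd_pow_path_mem`): Vandermonde merges two weights into one, and two
weights are handled by telescoping. -/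

open Nat in
/-- The reciprocal factorial product `1 / ((N + k)! (N - k)!)`, extended by zero to `k > N`. -/
def centralWeight (N k : ℕ) : ℚ :=
  if k ≤ N then 1 / (((N + k)! : ℚ) * ((N - k)! : ℚ)) else 0

theorem centralWeight_of_lt {N k : ℕ} (h : N < k) : centralWeight N k = 0 := by
  simp [centralWeight, Nat.not_le.mpr h]

open Nat in
theorem centralWeight_add (k j : ℕ) :
    centralWeight (k + j) k = 1 / (((k + j + k)! : ℚ) * (j ! : ℚ)) := by
  simp [centralWeight]

theorem sq_sub_sq_mul_centralWeight (N k : ℕ) :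
    (((N + 1 : ℕ) : ℚ) ^ 2 - (k : ℚ) ^ 2) * centralWeight (N + 1) k = centralWeight N k := by
  rcases lt_trichotomy k (N + 1) with h | h | h
  · obtain ⟨j, rfl⟩ := Nat.exists_eq_add_of_le (Nat.lt_succ_iff.mp h)
    rw [centralWeight_add, add_assoc k j 1, centralWeight_add,
      show k + (j + 1) + k = (k + j + k) + 1 by ring, Nat.factorial_succ, Nat.factorial_succ]
    have h1 : ((k + j + k).factorial : ℚ) ≠ 0 := by positivity
    have h2 : (j.factorial : ℚ) ≠ 0 := by positivity
    push_cast
    have h3 : (k : ℚ) + j + k + 1 ≠ 0 := by positivity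
    have h4 : (j : ℚ) + 1 ≠ 0 := by positivity
    field_simp
    ring
  · subst h
    rw [centralWeight_of_lt (Nat.lt_succ_self N)]
    ring
  · rw [centralWeight_of_lt h, centralWeight_of_lt (by omega), mul_zero]

theorem add_mul_centralWeight_succ (N k : ℕ) :
    ((N : ℚ) + (k + 1 : ℕ)) * centralWeight N (k + 1) = ((N : ℚ) - k) * centralWeight N k := by
  rcases lt_trichotomy k N with h | h | h
  · obtain ⟨j, rfl⟩ := Nat.exists_eq_add_of_lt h
    rw [show k + j + 1 = k + (j + 1) by ring, centralWeight_add,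
      show k + (j + 1) = (k + 1) + j by ring, centralWeight_add,
      show k + 1 + j + (k + 1) = (k + 1 + j + k) + 1 by ring, Nat.factorial_succ,
      Nat.factorial_succ j]
    have h1 : ((k + 1 + j + k).factorial : ℚ) ≠ 0 := by positivity
    have h2 : (j.factorial : ℚ) ≠ 0 := by positivity
    push_cast
    have h3 : (k : ℚ) + 1 + j + k + 1 ≠ 0 := by positivity
    have h4 : (j : ℚ) + 1 ≠ 0 := by positivity
    field_simp
    ring
  · subst h
    rw [centralWeight_of_lt (Nat.lt_succ_self k)]
    ring
  · rw [centralWeight_of_lt h, centralWeight_of_lt (by omega)]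
    ring

theorem sum_mul_centralWeight_telescope (a b M : ℕ) :
    ((a : ℚ) + b) * (2 * ∑ k ∈ Finset.range M,
        ((k + 1 : ℕ) : ℚ) * (centralWeight a (k + 1) * centralWeight b (k + 1))) =
      a * centralWeight a 0 * (b * centralWeight b 0) -
        ((a : ℚ) - M) * centralWeight a M * (((b : ℚ) - M) * centralWeight b M) := by
  induction M with
  | zero => simp
  | succ M ih =>
    rw [Finset.sum_range_succ, mul_add, mul_add, ih, ← add_mul_centralWeight_succ a M,
      ← add_mul_centralWeight_succ b M]
    push_cast
    ring

/-! ### Odd moments of a product of two weights -/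

/-- The subring of integers inside the rationals. -/
def intSubring : Subring ℚ := (Int.castRingHom ℚ).range

theorem natCast_mem_intSubring (n : ℕ) : (n : ℚ) ∈ intSubring := ⟨n, by simp⟩

-- The first moment telescopes; writing `k^2 = a^2 - (a^2 - k^2)` trades two powers of `k` for
-- lowering `a` by one.
open Nat in
theorem two_mul_sum_odd_pow_pair_mem (r a b M : ℕ) (hb : b ≤ M) :
    2 * ((a ! : ℚ) * b ! * (a + b)!) * ∑ k ∈ Finset.range M, ((k + 1 : ℕ) : ℚ) ^ (2 * r + 1) *
      (centralWeight a (k + 1) * centralWeight b (k + 1)) ∈ intSubring := by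
  induction r generalizing a with
  | zero =>
    rcases a with _ | a
    · simp [centralWeight_of_lt]
    have h := sum_mul_centralWeight_telescope (a + 1) b M
    -- The boundary term vanishes: at `M = b` by its factor, beyond that by its weight.
    have hz : ((b : ℚ) - M) * centralWeight b M = 0 := by
      rcases hb.eq_or_lt with rfl | hb
      · simp
      · rw [centralWeight_of_lt hb, mul_zero]
    rw [hz, mul_zero, sub_zero] at h
    convert mul_mem (natCast_mem_intSubring b) (natCast_mem_intSubring (choose (a + b) b)) using 1
    simp only [mul_zero, zero_add, pow_one]
    have h0 : ((a + 1 : ℕ) : ℚ) + b ≠ 0 := by positivity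
    replace h := eq_div_of_mul_eq h0 ((mul_comm _ _).trans h)
    rw [mul_comm (2 : ℚ), mul_assoc, h,
      Nat.cast_choose ℚ (Nat.le_add_left b a), Nat.add_sub_cancel,
      show a + 1 + b = (a + b) + 1 by ring, factorial_succ (a + b), factorial_succ a]
    simp only [centralWeight, Nat.zero_le, if_true, add_zero, Nat.sub_zero, factorial_succ a]
    push_cast
    have h1 : (a ! : ℚ) ≠ 0 := by positivity
    have h2 : (b ! : ℚ) ≠ 0 := by positivity
    have h3 : (a : ℚ) + 1 ≠ 0 := by positivity
    have h4 : (a : ℚ) + 1 + b ≠ 0 := by positivity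
    field_simp
    ring
  | succ r ih =>
    rcases a with _ | a
    · simp [centralWeight_of_lt]
    have h : ∀ k : ℕ, ((k + 1 : ℕ) : ℚ) ^ (2 * (r + 1) + 1) *
        (centralWeight (a + 1) (k + 1) * centralWeight b (k + 1)) =
        ((a + 1 : ℕ) : ℚ) ^ 2 * (((k + 1 : ℕ) : ℚ) ^ (2 * r + 1) *
          (centralWeight (a + 1) (k + 1) * centralWeight b (k + 1))) -
        ((k + 1 : ℕ) : ℚ) ^ (2 * r + 1) *
          (centralWeight a (k + 1) * centralWeight b (k + 1)) := by
      intro k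
      rw [← sq_sub_sq_mul_centralWeight a (k + 1)]
      ring
    rw [Finset.sum_congr rfl fun k _ => h k, Finset.sum_sub_distrib, ← Finset.mul_sum]
    convert sub_mem
      (mul_mem (pow_mem (natCast_mem_intSubring (a + 1)) 2) (ih (a + 1)))
      (mul_mem (mul_mem (natCast_mem_intSubring (a + 1)) (natCast_mem_intSubring (a + 1 + b)))
        (ih a)) using 1
    rw [show a + 1 + b = (a + b) + 1 by ring, factorial_succ (a + b), factorial_succ a]
    push_cast
    ring

/-! ### Chains of weights -/

-- Up to a factor free of `s`, the summand is `choose (a-k) (s-k) * choose (c+k) (c-s)`, so this is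
-- Vandermonde. The integer coefficients do not depend on `k`.
open Nat in
theorem sum_choose_mul_centralWeight (a c d k : ℕ) :
    ∑ s ∈ Finset.range (c + 1), ((choose a s : ℚ) * choose (c + d) (c - s)) *
        ((s ! : ℚ) * (s + d)! * centralWeight s k) =
      (a ! : ℚ) * (a + c)! * (c + d)! * (centralWeight a k * centralWeight c k) := by
  by_cases hc : c < k
  · rw [centralWeight_of_lt hc, mul_zero, mul_zero]
    refine Finset.sum_eq_zero fun s hs => ?_
    rw [centralWeight_of_lt (by rw [Finset.mem_range] at hs; omega), mul_zero, mul_zero]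
  by_cases ha : a < k
  · rw [centralWeight_of_lt ha, zero_mul, mul_zero]
    refine Finset.sum_eq_zero fun s hs => ?_
    rcases lt_or_ge a s with h | h
    · rw [choose_eq_zero_of_lt h]
      simp
    · rw [centralWeight_of_lt (by omega), mul_zero, mul_zero]
  obtain ⟨c, rfl⟩ := Nat.exists_eq_add_of_le (Nat.not_lt.mp hc)
  obtain ⟨a, rfl⟩ := Nat.exists_eq_add_of_le (Nat.not_lt.mp ha)
  rw [add_assoc k c 1, Finset.sum_range_add, Finset.sum_eq_zero, zero_add]
  swap
  · intro s hs
    rw [centralWeight_of_lt (Finset.mem_range.mp hs), mul_zero, mul_zero]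
  have hterm : ∀ j ∈ Finset.range (c + 1),
      ((choose (k + a) (k + j) : ℚ) * choose (k + c + d) (k + c - (k + j))) *
        (((k + j)! : ℚ) * (k + j + d)! * centralWeight (k + j) k) =
      ((k + a)! : ℚ) * (k + c + d)! / ((a ! : ℚ) * (k + c + k)!) *
        ((choose a j * choose (k + c + k) (c - j) : ℕ) : ℚ) := by
    intro j hj
    rcases lt_or_ge a j with h | h
    · rw [choose_eq_zero_of_lt h, choose_eq_zero_of_lt (show k + a < k + j by omega)]
      simp
    obtain ⟨i, rfl⟩ := Nat.exists_eq_add_of_le h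
    obtain ⟨e, rfl⟩ := Nat.exists_eq_add_of_le (Nat.lt_succ_iff.mp (Finset.mem_range.mp hj))
    rw [centralWeight_add]
    push_cast
    rw [Nat.cast_choose ℚ (show k + j ≤ k + (j + i) by omega),
      Nat.cast_choose ℚ (show k + (j + e) - (k + j) ≤ k + (j + e) + d by omega),
      Nat.cast_choose ℚ (show j ≤ j + i by omega),
      Nat.cast_choose ℚ (show j + e - j ≤ k + (j + e) + k by omega),
      show k + (j + i) - (k + j) = i by omega, show k + (j + e) - (k + j) = e by omega,
      show k + (j + e) + d - e = k + j + d by omega, show j + i - j = i by omega,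
      show j + e - j = e by omega, show k + (j + e) + k - e = k + j + k by omega]
    field_simp
  rw [Finset.sum_congr rfl hterm, ← Finset.mul_sum, ← Nat.cast_sum,
    ← Finset.Nat.sum_antidiagonal_eq_sum_range_succ
      (fun i j => choose a i * choose (k + c + k) j) c, ← Nat.add_choose_eq,
    Nat.cast_choose ℚ (show c ≤ a + (k + c + k) by omega), centralWeight_add, centralWeight_add,
    show a + (k + c + k) - c = k + a + k by omega,
    show k + a + (k + c) = a + (k + c + k) by omega]
  field_simp

open Nat in
/-- The product of `(x + y)!` over consecutive entries `x, y` of `a :: (l ++ [b])`. -/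
def pathFactorial : ℕ → List ℕ → ℕ → ℕ
  | a, [], b => (a + b)!
  | a, c :: l, b => (a + c)! * pathFactorial c l b

-- Here `d` is the entry following `a`; it serves as the `d` of `sum_choose_mul_centralWeight`.
open Nat in
theorem exists_pathFactorial_eq (l : List ℕ) (b : ℕ) :
    ∃ d q : ℕ, ∀ a, pathFactorial a l b = (a + d)! * q := by
  cases l with
  | nil => exact ⟨b, 1, fun a => by simp [pathFactorial]⟩
  | cons c l => exact ⟨c, pathFactorial c l b, fun a => rfl⟩

open Nat in
theorem two_mul_sum_odd_pow_path_mem (r b M : ℕ) (hb : b ≤ M) (l : List ℕ) (a : ℕ) :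
    2 * ((a ! : ℚ) * b ! * pathFactorial a l b) *
      ∑ k ∈ Finset.range M, ((k + 1 : ℕ) : ℚ) ^ (2 * r + 1) *
        (centralWeight a (k + 1) * centralWeight b (k + 1) *
          (l.map fun c => centralWeight c (k + 1)).prod) ∈ intSubring := by
  induction l generalizing a with
  | nil => simpa [pathFactorial] using two_mul_sum_odd_pow_pair_mem r a b M hb
  | cons c l ih =>
    obtain ⟨d, q, hq⟩ := exists_pathFactorial_eq l b
    have key := sum_mem fun s (_ : s ∈ Finset.range (c + 1)) =>
      mul_mem (mul_mem (natCast_mem_intSubring (choose a s))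
        (natCast_mem_intSubring (choose (c + d) (c - s)))) (ih s)
    convert key using 1
    simp only [pathFactorial, hq, Finset.mul_sum, List.map_cons, List.prod_cons]
    rw [Finset.sum_comm]
    refine Finset.sum_congr rfl fun k _ => ?_
    have h := sum_choose_mul_centralWeight a c d (k + 1)
    calc _ = ((a ! : ℚ) * (a + c)! * (c + d)! *
          (centralWeight a (k + 1) * centralWeight c (k + 1))) *
          (2 * (b ! : ℚ) * q * ((k + 1 : ℕ) : ℚ) ^ (2 * r + 1) * centralWeight b (k + 1) *
            (l.map fun c => centralWeight c (k + 1)).prod) := by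
          push_cast
          ring
      _ = _ := by
          rw [← h, Finset.sum_mul]
          refine Finset.sum_congr rfl fun s _ => ?_
          push_cast
          ring

open Nat in
theorem pathFactorial_replicate (b m : ℕ) :
    pathFactorial b (List.replicate m b) b = (2 * b)! ^ (m + 1) := by
  induction m with
  | zero => simp [pathFactorial, two_mul]
  | succ m ih => rw [List.replicate_succ, pathFactorial, ih, ← two_mul, pow_succ' _ (m + 1)]

open Nat in
theorem pathFactorial_replicate_append (a b m p : ℕ) :
    pathFactorial a (List.replicate m a ++ List.replicate p b) b =
      (2 * a)! ^ m * (a + b)! * (2 * b)! ^ p := by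
  induction m with
  | zero =>
    cases p with
    | zero => simp [pathFactorial]
    | succ p =>
      rw [List.replicate_zero, List.nil_append, List.replicate_succ, pathFactorial,
        pathFactorial_replicate]
      ring
  | succ m ih =>
    rw [List.replicate_succ, List.cons_append, pathFactorial, ih, ← two_mul]
    ring

open Nat in
theorem choose_two_mul_sub_eq {N k : ℕ} (h : k ≤ N) :
    (choose (2 * N) (N - k) : ℚ) = (2 * N)! * centralWeight N k := by
  rw [Nat.cast_choose ℚ (by omega), show 2 * N - (N - k) = N + k by omega, centralWeight, if_pos h]
  ring

/-- Twice an odd-power moment of `C(4n, 2n - k)^s C(2n, n - k)^t` is divisible by `C(4n, n)`. -/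
theorem two_mul_sum_odd_pow_choose (n r s t : ℕ) :
    ∃ z : ℤ, 2 * ∑ k ∈ Finset.Icc 1 n, (k : ℚ) ^ (2 * r + 1) *
      ((Nat.choose (2 * (2 * n)) (2 * n - k) : ℚ) ^ (s + 1) *
        (Nat.choose (2 * n) (n - k) : ℚ) ^ (t + 1)) = Nat.choose (4 * n) n * z := by
  -- Grouping equal entries leaves a single mixed factor `(3n)!`; with `n!` it forms the denominator
  -- of `choose (4n) n`.
  obtain ⟨z, hz⟩ := two_mul_sum_odd_pow_path_mem r n n le_rfl
    (List.replicate s (2 * n) ++ List.replicate t n) (2 * n)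
  refine ⟨z, ?_⟩
  rw [eq_intCast] at hz
  rw [hz, pathFactorial_replicate_append, Finset.range_eq_Ico,
    Finset.sum_Ico_add' (fun k : ℕ => (k : ℚ) ^ (2 * r + 1) *
        (centralWeight (2 * n) k * centralWeight n k *
          ((List.replicate s (2 * n) ++ List.replicate t n).map
            fun c => centralWeight c k).prod)) 0 n 1, zero_add,
    Finset.mul_sum, Finset.mul_sum, Finset.mul_sum]
  refine Finset.sum_congr rfl fun k hk => ?_
  have hk' : k ≤ n := (Finset.mem_Icc.mp hk).2
  rw [choose_two_mul_sub_eq hk', choose_two_mul_sub_eq (show k ≤ 2 * n by omega),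
    Nat.cast_choose ℚ (show n ≤ 4 * n by omega), show 4 * n - n = 2 * n + n by omega,
    show 2 * (2 * n) = 4 * n by ring]
  simp only [List.map_append, List.map_replicate, List.prod_append, List.prod_replicate]
  push_cast
  field_simp
  ring

/-! ### Parity, integrality and the conclusion -/

theorem odd_choose_two_pow_sub_one (m j : ℕ) (hj : j < 2 ^ m) :
    Odd (Nat.choose (2 ^ m - 1) j) := by
  induction j with
  | zero => simp
  | succ j ih =>
    -- By Pascal's rule, neighbours in row `2^m - 1` sum to an even number.
    have h := Nat.prime_two.dvd_choose_pow (n := m) (k := j + 1) (by omega) (by omega)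
    rw [show 2 ^ m = (2 ^ m - 1) + 1 by omega, Nat.choose_succ_succ, ← even_iff_two_dvd,
      Nat.even_add] at h
    rw [← Nat.not_even_iff_odd, ← h, Nat.not_even_iff_odd]
    exact ih (by omega)

theorem catalanTriangle_mem_intSubring {n k : ℕ} (hk : 1 ≤ k) (hkn : k ≤ n) :
    catalanTriangle n k ∈ intSubring := by
  have hn : (n : ℚ) ≠ 0 := by
    have : n ≠ 0 := by omega
    exact_mod_cast this
  unfold catalanTriangle
  obtain ⟨j, rfl⟩ := Nat.exists_eq_add_of_le hkn
  rw [Nat.add_sub_cancel_left]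
  rcases j with _ | j
  · have hk0 : (k : ℚ) ≠ 0 := by simpa using hn
    simp [hk0]
  -- `k/n = 1 - (n-k)/n`, and absorption gives `(n-k)/n * choose (2n) (n-k) = 2 * choose (2n-1)
  -- (n-k-1)`.
  convert sub_mem (natCast_mem_intSubring (Nat.choose (2 * (k + (j + 1))) (j + 1)))
    (mul_mem (natCast_mem_intSubring 2)
      (natCast_mem_intSubring (Nat.choose (2 * (k + j) + 1) j))) using 1
  have h := Nat.add_one_mul_choose_eq (2 * (k + j) + 1) j
  rw [show 2 * (k + j) + 1 + 1 = 2 * (k + (j + 1)) by ring] at h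
  have h' : (2 * ((k : ℚ) + (j + 1))) * (Nat.choose (2 * (k + j) + 1) j : ℚ) =
      (Nat.choose (2 * (k + (j + 1))) (j + 1) : ℚ) * (j + 1) := by exact_mod_cast h
  push_cast at hn ⊢
  field_simp
  linear_combination h'

theorem corollary6p6 (n : ℕ) (hn : ∃ a : ℕ, n = 2 ^ a) (r s t : ℕ) (hs : 1 ≤ s) (ht : 1 ≤ t)
    (hodd : Odd (r + s + t)) :
    ∃ z : ℤ,
      ∑ k ∈ Finset.Icc 1 n,
          (k : ℚ) ^ r * catalanTriangle (2 * n) k ^ s * catalanTriangle n k ^ t =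
        (Nat.choose (4 * n - 1) (n - 1) : ℚ) * (z : ℚ) := by
  obtain ⟨a, rfl⟩ := hn
  obtain ⟨e, he⟩ := hodd
  obtain ⟨s, rfl⟩ := Nat.exists_eq_add_of_le' hs
  obtain ⟨t, rfl⟩ := Nat.exists_eq_add_of_le' ht
  set n : ℕ := 2 ^ a with hn
  have hn0 : 0 < n := by positivity
  have hnQ : (n : ℚ) ≠ 0 := by positivity
  obtain ⟨x, hx⟩ : ∑ k ∈ Finset.Icc 1 n, (k : ℚ) ^ r * catalanTriangle (2 * n) k ^ (s + 1) *
      catalanTriangle n k ^ (t + 1) ∈ intSubring := by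
    refine sum_mem fun k hk => ?_
    obtain ⟨h1, h2⟩ := Finset.mem_Icc.mp hk
    exact mul_mem (mul_mem (pow_mem (natCast_mem_intSubring k) _)
      (pow_mem (catalanTriangle_mem_intSubring h1 (by omega)) _))
      (pow_mem (catalanTriangle_mem_intSubring h1 h2) _)
  rw [eq_intCast] at hx
  obtain ⟨z, hz⟩ := two_mul_sum_odd_pow_choose n e s t
  have hchoose : Nat.choose (4 * n) n = 4 * Nat.choose (4 * n - 1) (n - 1) := by
    have h := Nat.add_one_mul_choose_eq (4 * n - 1) (n - 1)
    rw [show 4 * n - 1 + 1 = 4 * n by omega, show n - 1 + 1 = n by omega] at h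
    refine Nat.eq_of_mul_eq_mul_right hn0 ?_
    rw [← h]
    ring
  have hscale : (2 * ((2 * n : ℕ) : ℚ) ^ (s + 1) * (n : ℚ) ^ (t + 1)) * (x : ℚ) =
      Nat.choose (4 * n - 1) (n - 1) * (4 * z : ℤ) := by
    rw [hchoose] at hz
    push_cast at hz ⊢
    rw [hx, mul_left_comm, ← mul_assoc, ← hz, mul_assoc 2, mul_assoc 2]
    congr 1
    rw [Finset.mul_sum]
    refine Finset.sum_congr rfl fun k _ => ?_
    unfold catalanTriangle
    rw [← he]
    push_cast
    simp only [mul_pow, div_pow]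
    field_simp
    ring
  have hdvd : ((Nat.choose (4 * n - 1) (n - 1) : ℕ) : ℤ) ∣
      ((2 ^ (1 + (a + 1) * (s + 1) + a * (t + 1)) : ℕ) : ℤ) * x := by
    refine ⟨4 * z, ?_⟩
    have h2 : (2 * (2 * n) ^ (s + 1) * n ^ (t + 1) : ℕ) =
        2 ^ (1 + (a + 1) * (s + 1) + a * (t + 1)) := by
      rw [hn]
      ring
    rw [← h2]
    exact_mod_cast hscale
  have hcop : IsCoprime ((Nat.choose (4 * n - 1) (n - 1) : ℕ) : ℤ)
      ((2 ^ (1 + (a + 1) * (s + 1) + a * (t + 1)) : ℕ) : ℤ) := by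
    rw [Nat.isCoprime_iff_coprime]
    refine Nat.Coprime.pow_right _ (Nat.coprime_two_right.mpr ?_)
    have h4 : 4 * n = 2 ^ (a + 2) := by rw [hn]; ring
    rw [h4]
    exact odd_choose_two_pow_sub_one _ _ (by omega)
  obtain ⟨w, hw⟩ := hcop.dvd_of_dvd_mul_left hdvd
  refine ⟨w, ?_⟩
  rw [← hx, hw]
  push_cast
  rfl
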